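/- For $\alpha>0$, $\xi\in(0,1)$ put $\nu=\nu(\alpha):=\tfrac12\sqrt{1-4\alpha}$ and, for $m,x\in\mathbb Z$, $$\boldsymbol\varphi_m(x;\alpha,\xi):=\left(\frac{\Gamma(\frac12+\nu+x)\,\Gamma(\frac12-\nu+x)}{\Gamma(\frac12+\nu-m)\,\Gamma(\frac12-\nu-m)}\right)^{1/2}\xi^{\frac12(x+m)}(1-\xi)^{-m}\,\frac{{}_2F_1\big(\frac12+\nu+m,\frac12-\nu+m;x+m+1;\frac{\xi}{\xi-1}\big)}{\Gamma(x+m+1)},$$ where the quotient of Gamma functions under the root is positive, and ${}_2F_1(A,B;C;w)/\Gamma(C)$ is the regularized Gauss hypergeometric function on $\mathbb C\setminus[1,\infty)$: the analytic continuation of $\sum_{n\ge0}\frac{(A)_n(B)_n}{\Gamma(C+n)\,n!}w^n$ $(|w|<1)$, which is defined for all $C$. For $x,y\in\mathbb Z$ and $0\le s\le t$ let $$\boldsymbol\Phi_{\alpha,\xi}(s,x;t,y):=(-1)^{x\wedge0+y\vee0}\sum_{m=0}^\infty2^{-\delta(m)}e^{-m(t-s)}\boldsymbol\varphi_m(x;\alpha,\xi)\,\boldsymbol\varphi_m(-y;\alpha,\xi),$$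 where $\delta(m)=\delta_{m,0}$ is the Kronecker delta, $x\wedge0=\min(x,0)$, $y\vee0=\max(y,0)$. Let $J_k(z)=\sum_{r\ge0}\frac{(-1)^r(z/2)^{2r+k}}{r!\,\Gamma(r+k+1)}$, $k\in\mathbb Z$, be the Bessel function of the first kind (with $1/\Gamma:=0$ at $0,-1,-2,\dots$). **Theorem.** Let $\theta>0$, and let $\alpha\to+\infty$ and $\xi\to0$ (with $\alpha>0$, $\xi\in(0,1)$) in such a way that $\alpha\xi\to\theta$. Then for all $x,y\in\mathbb Z$ and all real $0\le s\le t$ the kernel $\boldsymbol\Phi_{\alpha,\xi}(s,x;t,y)$ converges to $$\boldsymbol\Phi_\theta(s,x;t,y)=(-1)^{x\wedge0+y\vee0}\sum_{m=0}^\infty2^{-\delta(m)}e^{-m(t-s)}J_{m+x}(2\sqrt\theta)\,J_{m-y}(2\sqrt\theta).$$ Here the last series converges absolutely, and so does the series defining $\boldsymbol\Phi_{\alpha,\xi}(s,x;t,y)$ eventually along the limit. -/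

import Mathlib

open Filter Topology

noncomputable section

/-- The parameter `ν(α) = √(1 - 4α) / 2`; it lies in `[0, 1/2)` for `0 < α ≤ 1/4` and is purely
imaginary for `α > 1/4`. -/
def nuParam (α : ℝ) : ℂ := (1 / 2) * ((1 : ℂ) - 4 * (α : ℂ)) ^ (1 / 2 : ℂ)

/-- The cut plane `ℂ ∖ [1, ∞)`. -/
def hypergeomDomain : Set ℂ := {w : ℂ | 1 - w ∈ Complex.slitPlane}

/-- `f` is an analytic continuation to `ℂ ∖ [1, ∞)` of `₂F₁(A, B; C; ·) / Γ(C)`, i.e. of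
the power series `∑ₙ (A)ₙ (B)ₙ / (Γ(C + n) n!) zⁿ`, which is meaningful for `‖z‖ < 1` and every
complex `C`. -/
def IsHypergeomContinuation (A B C : ℂ) (f : ℂ → ℂ) : Prop :=
  AnalyticOnNhd ℂ f hypergeomDomain ∧ ∀ z : ℂ, ‖z‖ < 1 → f z = Complex.regularizedGaussHGFun A B C z

open Classical in
/-- The regularized Gauss hypergeometric function `₂F₁(A, B; C; w) / Γ(C)` on `ℂ ∖ [1, ∞)`: the sum
of the series inside the unit disc, and its analytic continuation outside of it. -/
def hypergeomReg (A B C w : ℂ) : ℂ :=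
  if ‖w‖ < 1 then Complex.regularizedGaussHGFun A B C w
  else if h : ∃ f : ℂ → ℂ, IsHypergeomContinuation A B C f then h.choose w
  else 0

/-- The analytic continuation is unique, so the choice made in `hypergeomReg` is immaterial. -/
theorem hypergeomReg_eq_of_continuation {A B C : ℂ} {f : ℂ → ℂ}
    (hf : IsHypergeomContinuation A B C f) {w : ℂ} (hw : w ∈ hypergeomDomain) :
    hypergeomReg A B C w = f w := by
  have key : ∀ g : ℂ → ℂ, IsHypergeomContinuation A B C g → g w = f w := by
    intro g hg
    have h0 : (0 : ℂ) ∈ hypergeomDomain := by simp [hypergeomDomain]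
    have hpre : IsPreconnected hypergeomDomain := by
      have h1 : hypergeomDomain = (fun z : ℂ => 1 - z) '' Complex.slitPlane := by
        ext z
        constructor
        · intro hz
          exact ⟨1 - z, hz, by ring⟩
        · rintro ⟨u, hu, rfl⟩
          simpa [hypergeomDomain] using hu
      rw [h1]
      exact (StarConvex.isPathConnected Complex.starConvex_one_slitPlane
        Complex.one_mem_slitPlane).isConnected.isPreconnected.image _ (by fun_prop)
    have hev : g =ᶠ[𝓝 0] f := by
      filter_upwards [Metric.ball_mem_nhds (0 : ℂ) one_pos] with z hz
      have hz' : ‖z‖ < 1 := by simpa using hz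
      rw [hg.2 z hz', hf.2 z hz']
    exact hg.1.eqOn_of_preconnected_of_eventuallyEq hf.1 hpre h0 hev hw
  unfold hypergeomReg
  split_ifs with h1 h2
  · exact (hf.2 w h1).symm
  · exact key _ h2.choose_spec
  · exact absurd ⟨f, hf⟩ h2

/-- The function `φ_m(x; α, ξ)`, for `m, x ∈ ℤ`, `α > 0` and `0 < ξ < 1`. In this range the quotient
of Gamma functions is a positive real number and the value is real. -/
def phiFun (m x : ℤ) (α ξ : ℝ) : ℂ :=
  (Complex.Gamma (1 / 2 + nuParam α + x) * Complex.Gamma (1 / 2 - nuParam α + x)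
      / (Complex.Gamma (1 / 2 + nuParam α - m) * Complex.Gamma (1 / 2 - nuParam α - m)))
        ^ (1 / 2 : ℂ)
    * ((ξ ^ (((x : ℝ) + (m : ℝ)) / 2) : ℝ) : ℂ) * ((1 - ξ : ℝ) : ℂ) ^ (-m)
    * hypergeomReg (1 / 2 + nuParam α + m) (1 / 2 - nuParam α + m) ((x : ℂ) + m + 1)
        ((ξ / (ξ - 1) : ℝ) : ℂ)

/-- The Kronecker delta `δ(m) = δ_{m,0}`. -/
def kronZero (m : ℕ) : ℤ := if m = 0 then 1 else 0

/-- The `m`-th term of the series defining `Φ_{α,ξ}(s, x; t, y)`. -/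
def extKernelTerm (α ξ s : ℝ) (x : ℤ) (t : ℝ) (y : ℤ) (m : ℕ) : ℂ :=
  (2 : ℂ) ^ (-kronZero m) * (Real.exp (-(m : ℝ) * (t - s)) : ℂ)
    * phiFun m x α ξ * phiFun m (-y) α ξ

/-- The extended Pfaffian hypergeometric-type kernel `Φ_{α,ξ}(s, x; t, y)`. -/
def extKernel (α ξ s : ℝ) (x : ℤ) (t : ℝ) (y : ℤ) : ℂ :=
  (-1 : ℂ) ^ (min x 0 + max y 0) * ∑' m : ℕ, extKernelTerm α ξ s x t y m

/-- The Bessel function of the first kind `J_k(z)` of integer order at real `z ≠ 0`: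
`∑ᵣ (-1)^r (z/2)^(2r+k) / (r! Γ(r+k+1))`, where `1/Γ` vanishes at the nonpositive integers. -/
def besselJ (k : ℤ) (z : ℝ) : ℝ :=
  ∑' r : ℕ, (-1 : ℝ) ^ r * (z / 2) ^ (2 * (r : ℤ) + k)
    / ((r.factorial : ℝ)) * (Real.Gamma ((r : ℝ) + (k : ℝ) + 1))⁻¹

/-- The `m`-th term of the series defining the limiting kernel `Φ_θ(s, x; t, y)`. -/
def besselKernelTerm (θ s : ℝ) (x : ℤ) (t : ℝ) (y : ℤ) (m : ℕ) : ℝ :=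
  (2 : ℝ) ^ (-kronZero m) * Real.exp (-(m : ℝ) * (t - s))
    * besselJ (m + x) (2 * √θ) * besselJ (m - y) (2 * √θ)

/-- The limiting kernel `Φ_θ(s, x; t, y)`. -/
def besselKernel (θ s : ℝ) (x : ℤ) (t : ℝ) (y : ℤ) : ℝ :=
  (-1 : ℝ) ^ (min x 0 + max y 0) * ∑' m : ℕ, besselKernelTerm θ s x t y m

end

/-! Since `ν² = 1/4 - α`, one has `(1/2 + ν + z)(1/2 - ν + z) = z(z + 1) + α`. All Gamma quotients
and Pochhammer products thus become real products of factors `k(k + 1) + α`, and `φ_m` is a real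
series (`phiFun_eq_tsum`). Each factor times `ξ` tends to `θ`, and `(ξ - 1)⁻¹ → -1`, so the terms
tend to those of the Bessel series (`tendsto_phiTerm`). For small `ξ` the terms are at most `K 2⁻ᵐ
64⁻ⁿ`, uniformly along the limit (`abs_phiTerm_le`). Dominated convergence in `n` gives `φ_m →
J_{m+x}`, and in `m`, with majorant of order `4⁻ᵐ`, the kernel limit. -/

/-! ### Gamma and Pochhammer products in terms of `k(k + 1) + α`. -/

theorem nuParam_sq (α : ℝ) : nuParam α ^ 2 = 1 / 4 - α := by
  have h : (((1 : ℂ) - 4 * (α : ℂ)) ^ (1 / 2 : ℂ)) ^ 2 = 1 - 4 * α := by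
    rw [one_div]; exact Complex.cpow_ofNat_inv_pow _ 2
  rw [nuParam, mul_pow, h]; ring

/-- Consecutive integers never have opposite signs; this makes the Gamma quotient positive. -/
theorem int_mul_succ_add_pos {α : ℝ} (hα : 0 < α) (k : ℤ) : 0 < (k : ℝ) * (k + 1) + α := by
  have h : (0 : ℤ) ≤ k * (k + 1) := by
    rcases le_or_gt 0 k with h | h
    · positivity
    · exact mul_nonneg_of_nonpos_of_nonpos h.le (by lia)
  have h' : (0 : ℝ) ≤ (k : ℝ) * (k + 1) := by exact_mod_cast h
  linarith

theorem half_add_nuParam_mul (α : ℝ) (z : ℂ) :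
    (1 / 2 + nuParam α + z) * (1 / 2 - nuParam α + z) = z * (z + 1) + α := by
  linear_combination -nuParam_sq α

/-- The product `Γ(1/2 + ν + k) Γ(1/2 - ν + k)`. -/
noncomputable def gammaPair (α : ℝ) (k : ℤ) : ℂ :=
  Complex.Gamma (1 / 2 + nuParam α + k) * Complex.Gamma (1 / 2 - nuParam α + k)

theorem half_add_nuParam_mul_ne_zero {α : ℝ} (hα : 0 < α) (k : ℤ) :
    (1 / 2 + nuParam α + k) * (1 / 2 - nuParam α + k) ≠ 0 := by
  rw [half_add_nuParam_mul]
  exact_mod_cast (int_mul_succ_add_pos hα k).ne'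

theorem gammaPair_ne_zero {α : ℝ} (hα : 0 < α) (k : ℤ) : gammaPair α k ≠ 0 := by
  refine mul_ne_zero (Complex.Gamma_ne_zero fun m h => ?_) (Complex.Gamma_ne_zero fun m h => ?_)
  · apply left_ne_zero_of_mul (half_add_nuParam_mul_ne_zero hα (k + m))
    push_cast
    linear_combination h
  · apply right_ne_zero_of_mul (half_add_nuParam_mul_ne_zero hα (k + m))
    push_cast
    linear_combination h

theorem gammaPair_succ {α : ℝ} (hα : 0 < α) (k : ℤ) :
    gammaPair α (k + 1) = (((k : ℝ) * (k + 1) + α : ℝ) : ℂ) * gammaPair α k := by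
  have h := half_add_nuParam_mul_ne_zero hα k
  have h1 := Complex.Gamma_add_one _ (left_ne_zero_of_mul h)
  have h2 := Complex.Gamma_add_one _ (right_ne_zero_of_mul h)
  have h3 := half_add_nuParam_mul α k
  unfold gammaPair
  push_cast
  rw [← add_assoc, ← add_assoc, h1, h2, ← h3]
  ring

theorem tendsto_mul_add_div_self (c : ℝ) :
    Tendsto (fun α : ℝ => (c + α) * α⁻¹) atTop (𝓝 1) := by
  have h : Tendsto (fun α : ℝ => c * α⁻¹ + 1) atTop (𝓝 (c * 0 + 1)) :=
    (tendsto_inv_atTop_zero.const_mul c).add_const 1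
  rw [mul_zero, zero_add] at h
  refine h.congr' ?_
  filter_upwards [eventually_gt_atTop 0] with α hα
  field_simp

/-- The recurrence `gammaPair_succ`, run upwards or downwards from `0`, contributes one factor
asymptotic to `α` or `α⁻¹` per step. -/
theorem exists_gammaPair_ratio (x : ℤ) : ∃ r : ℝ → ℝ,
    (∀ α, 0 < α → 0 < r α ∧ gammaPair α x = r α * gammaPair α 0) ∧
      Tendsto (fun α => r α * α ^ (-x)) atTop (𝓝 1) := by
  induction x using Int.induction_on with
  | zero => exact ⟨fun _ => 1, fun α _ => ⟨one_pos, by simp⟩, by simp⟩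
  | succ k ih =>
    obtain ⟨r, h1, h2⟩ := ih
    refine ⟨fun α => (((k : ℤ) : ℝ) * ((k : ℤ) + 1) + α) * r α, fun α hα => ⟨?_, ?_⟩, ?_⟩
    · exact mul_pos (int_mul_succ_add_pos hα k) (h1 α hα).1
    · rw [gammaPair_succ hα, (h1 α hα).2]; push_cast; ring
    · have := (tendsto_mul_add_div_self (((k : ℤ) : ℝ) * ((k : ℤ) + 1))).mul h2
      rw [one_mul] at this
      refine this.congr' ?_
      filter_upwards [eventually_gt_atTop 0] with α hα
      rw [neg_add, zpow_add₀ hα.ne', zpow_neg_one]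
      ring
  | pred k ih =>
    obtain ⟨r, h1, h2⟩ := ih
    refine ⟨fun α => (((-(k : ℤ) - 1 : ℤ) : ℝ) * ((-(k : ℤ) - 1 : ℤ) + 1) + α)⁻¹ * r α,
      fun α hα => ⟨?_, ?_⟩, ?_⟩
    · exact mul_pos (inv_pos.2 (int_mul_succ_add_pos hα _)) (h1 α hα).1
    · have h := gammaPair_succ hα (-(k : ℤ) - 1)
      rw [sub_add_cancel, (h1 α hα).2] at h
      have h0 : (((((-(k : ℤ) - 1 : ℤ) : ℝ) * ((-(k : ℤ) - 1 : ℤ) + 1) + α : ℝ)) : ℂ) ≠ 0 := by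
        exact_mod_cast (int_mul_succ_add_pos hα _).ne'
      rw [Complex.ofReal_mul, Complex.ofReal_inv, mul_assoc, h, inv_mul_cancel_left₀ h0]
    · have := ((tendsto_mul_add_div_self
        (((-(k : ℤ) - 1 : ℤ) : ℝ) * ((-(k : ℤ) - 1 : ℤ) + 1))).inv₀ one_ne_zero).mul h2
      rw [inv_one, one_mul] at this
      refine this.congr' ?_
      filter_upwards [eventually_gt_atTop 0] with α hα
      rw [show -(-(k : ℤ) - 1) = -(-(k : ℤ)) + 1 by ring, zpow_add₀ hα.ne', zpow_one, mul_inv,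
        inv_inv]
      ring

theorem gammaPair_zero {α : ℝ} (hα : 0 < α) (m : ℕ) :
    gammaPair α 0 =
      ((∏ k ∈ Finset.range m, ((k : ℝ) * (k + 1) + α) : ℝ) : ℂ) * gammaPair α (-m) := by
  induction m with
  | zero => simp
  | succ m ih =>
    have h := gammaPair_succ hα (-(m + 1 : ℕ))
    rw [show (-(m + 1 : ℕ) + 1 : ℤ) = -m by push_cast; ring] at h
    rw [ih, h, Finset.prod_range_succ]
    push_cast
    ring

theorem ascPochhammer_eval_mul (α : ℝ) (m n : ℕ) :
    (ascPochhammer ℂ n).eval (1 / 2 + nuParam α + m) *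
        (ascPochhammer ℂ n).eval (1 / 2 - nuParam α + m) =
      ((∏ j ∈ Finset.range n, (((m + j : ℕ) : ℝ) * ((m + j : ℕ) + 1) + α) : ℝ) : ℂ) := by
  induction n with
  | zero => simp
  | succ n ih =>
    have h := half_add_nuParam_mul α (m + n : ℕ)
    rw [ascPochhammer_succ_right, Finset.prod_range_succ, Complex.ofReal_mul, ← ih]
    push_cast at h ⊢
    simp only [Polynomial.eval_mul, Polynomial.eval_add, Polynomial.eval_X,
      Polynomial.eval_natCast]
    rw [← h]
    ring

/-! ### `φ_m` as a real series. -/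

theorem regularizedGaussHGFun_eq_tsum (A B C z : ℂ) :
    Complex.regularizedGaussHGFun A B C z = ∑' n : ℕ,
      (ascPochhammer ℂ n).eval A * (ascPochhammer ℂ n).eval B /
        (n.factorial * Complex.Gamma (C + n)) * z ^ n := by
  rw [Complex.regularizedGaussHGFun, Complex.regularizedGaussHGFunSeries,
    Complex.regularizedHGFunSeries]
  refine (FormalMultilinearSeries.ofScalars_sum_eq _ z).trans (tsum_congr fun n => ?_)
  simp [Complex.regularizedHGFunCoeff]

/-- The terms of the series for `φ_m(x; α, ξ)`, where `r` is the value of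
`Γ(1/2 + ν + x) Γ(1/2 - ν + x) / (Γ(1/2 + ν) Γ(1/2 - ν))`. -/
noncomputable def phiTerm (r α ξ : ℝ) (x : ℤ) (m n : ℕ) : ℝ :=
  √(r * ξ ^ x * ∏ k ∈ Finset.range m, (((k : ℝ) * (k + 1) + α) * ξ)) * ((1 - ξ)⁻¹) ^ m *
    ((∏ j ∈ Finset.range n, (((m + j : ℕ) : ℝ) * ((m + j : ℕ) + 1) + α)) *
      (ξ / (ξ - 1)) ^ n / n.factorial * (Real.Gamma (((m + n : ℕ) : ℝ) + x + 1))⁻¹)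

theorem phiFun_eq_tsum {r α ξ : ℝ} {x : ℤ} (hα : 0 < α) (hξ : 0 < ξ) (hξ' : ξ < 1 / 2)
    (hr : 0 < r) (hrx : gammaPair α x = r * gammaPair α 0) (m : ℕ) :
    phiFun m x α ξ = ((∑' n, phiTerm r α ξ x m n : ℝ) : ℂ) := by
  -- This is where `ξ < 1/2` enters: the power series suffices, without continuation.
  have hz : ‖((ξ / (ξ - 1) : ℝ) : ℂ)‖ < 1 := by
    rw [Complex.norm_real, Real.norm_eq_abs, abs_div, abs_of_pos hξ,
      abs_of_neg (by linarith : ξ - 1 < 0), div_lt_one] <;> linarith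
  set P : ℝ := ∏ k ∈ Finset.range m, ((k : ℝ) * (k + 1) + α) with hP
  have hP0 : 0 < P := Finset.prod_pos fun k _ => by positivity
  have hratio : Complex.Gamma (1 / 2 + nuParam α + x) * Complex.Gamma (1 / 2 - nuParam α + x)
      / (Complex.Gamma (1 / 2 + nuParam α - m) * Complex.Gamma (1 / 2 - nuParam α - m))
        = ((r * P : ℝ) : ℂ) := by
    have h1 : Complex.Gamma (1 / 2 + nuParam α - m) * Complex.Gamma (1 / 2 - nuParam α - m)
        = gammaPair α (-m) := by simp [gammaPair, sub_eq_add_neg]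
    have h2 := gammaPair_zero hα m
    rw [← hP] at h2
    have h3 := gammaPair_ne_zero hα (-m)
    rw [h1, div_eq_iff h3]
    change gammaPair α x = _
    rw [hrx, h2]; push_cast; ring
  have hsqrt : ((r * P : ℝ) : ℂ) ^ (1 / 2 : ℂ) * ((ξ ^ (((x : ℝ) + ((m : ℤ) : ℝ)) / 2) : ℝ) : ℂ)
      = ((√(r * ξ ^ x * ∏ k ∈ Finset.range m, (((k : ℝ) * (k + 1) + α) * ξ)) : ℝ) : ℂ) := by
    have e1 : ((1 / 2 : ℂ)) = ((1 / 2 : ℝ) : ℂ) := by norm_num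
    rw [e1, ← Complex.ofReal_cpow (by positivity), ← Complex.ofReal_mul,
      Finset.prod_mul_distrib, ← hP, Finset.prod_const, Finset.card_range, Real.sqrt_eq_rpow,
      show r * ξ ^ x * (P * ξ ^ m) = (r * P) * (ξ ^ x * ξ ^ m) by ring,
      Real.mul_rpow (x := r * P) (by positivity) (by positivity)]
    congr 2
    rw [← zpow_natCast ξ m, ← zpow_add₀ hξ.ne', ← Real.rpow_intCast, ← Real.rpow_mul hξ.le]
    congr 1
    push_cast; ring
  have hdef : phiFun m x α ξ = ((r * P : ℝ) : ℂ) ^ (1 / 2 : ℂ)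
      * ((ξ ^ (((x : ℝ) + ((m : ℤ) : ℝ)) / 2) : ℝ) : ℂ) * ((1 - ξ : ℝ) : ℂ) ^ (-(m : ℤ))
      * hypergeomReg (1 / 2 + nuParam α + m) (1 / 2 - nuParam α + m) ((x : ℂ) + m + 1)
        ((ξ / (ξ - 1) : ℝ) : ℂ) := by
    simp only [phiFun, Int.cast_natCast, hratio]
  rw [hdef, hsqrt, hypergeomReg, if_pos hz, regularizedGaussHGFun_eq_tsum, Complex.ofReal_tsum,
    ← tsum_mul_left]
  refine tsum_congr fun n => ?_
  rw [ascPochhammer_eval_mul, zpow_neg, zpow_natCast, ← inv_pow, phiTerm,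
    show (x : ℂ) + m + 1 + n = ((((m + n : ℕ) : ℝ) + x + 1 : ℝ) : ℂ) by push_cast; ring,
    Complex.Gamma_ofReal]
  push_cast
  rw [div_eq_mul_inv, div_eq_mul_inv, div_eq_mul_inv, mul_inv]
  ring

/-! ### Uniform bounds for the terms. -/

theorem prod_range_sq_mul (ε : ℝ) (N : ℕ) :
    ∏ k ∈ Finset.range N, ε * ((k : ℝ) + 1) ^ 2 = ε ^ N * (N.factorial : ℝ) ^ 2 := by
  induction N with
  | zero => simp
  | succ N ih => rw [Finset.prod_range_succ, ih, Nat.factorial_succ]; push_cast; ring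

/-- Adding `C` multiplies the `k`-th factor by `1 + C / (ε (k + 1)²)`, and the product of these
corrections converges. -/
theorem exists_prod_le_pow_mul_factorial_sq {ε C : ℝ} (hε : 0 < ε) (hC : 0 ≤ C) :
    ∃ D, 0 ≤ D ∧ ∀ N : ℕ, ∏ k ∈ Finset.range N, (ε * ((k : ℝ) + 1) ^ 2 + C) ≤
      D * (ε ^ N * (N.factorial : ℝ) ^ 2) := by
  have hs : Summable fun k : ℕ => C / ε * (1 / ((k : ℝ) + 1) ^ 2) := by
    refine Summable.mul_left _ ?_
    have := (summable_nat_add_iff 1).2 (Real.summable_one_div_nat_pow.2 one_lt_two)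
    simpa using this
  refine ⟨Real.exp (∑' k : ℕ, C / ε * (1 / ((k : ℝ) + 1) ^ 2)), (Real.exp_pos _).le,
    fun N => ?_⟩
  calc ∏ k ∈ Finset.range N, (ε * ((k : ℝ) + 1) ^ 2 + C)
      ≤ ∏ k ∈ Finset.range N, Real.exp (C / ε * (1 / ((k : ℝ) + 1) ^ 2)) *
          (ε * ((k : ℝ) + 1) ^ 2) := by
        refine Finset.prod_le_prod (fun k _ => by positivity) fun k _ => ?_
        have h := mul_le_mul_of_nonneg_right
          (Real.add_one_le_exp (C / ε * (1 / ((k : ℝ) + 1) ^ 2)))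
          (by positivity : 0 ≤ ε * ((k : ℝ) + 1) ^ 2)
        refine le_trans (le_of_eq ?_) h
        field_simp
        ring
    _ = Real.exp (∑ k ∈ Finset.range N, C / ε * (1 / ((k : ℝ) + 1) ^ 2)) *
          (ε ^ N * (N.factorial : ℝ) ^ 2) := by
        rw [Finset.prod_mul_distrib, ← Real.exp_sum, prod_range_sq_mul]
    _ ≤ _ := by
        gcongr
        exact hs.sum_le_tsum _ fun k _ => by positivity

theorem factorial_mul_abs_inv_Gamma_le (x : ℤ) (N : ℕ) :
    N.factorial * |(Real.Gamma ((N : ℝ) + x + 1))⁻¹| ≤ x.natAbs.factorial * 2 ^ N := by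
  rcases lt_or_ge ((N : ℤ) + x) 0 with h | h
  · obtain ⟨q, hq⟩ : ∃ q : ℕ, (N : ℤ) + x + 1 = -q := ⟨(-(N + x + 1)).toNat, by lia⟩
    have hq' : (N : ℝ) + x + 1 = -q := by exact_mod_cast hq
    -- `Real.Gamma` is `0` at its poles and `0⁻¹ = 0`, in accordance with `1/Γ = 0` there.
    rw [hq', Real.Gamma_neg_nat_eq_zero, inv_zero, abs_zero, mul_zero]
    positivity
  · obtain ⟨q, hq⟩ := Int.eq_ofNat_of_zero_le h
    have hq' : (N : ℝ) + x = q := by exact_mod_cast hq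
    rw [hq', Real.Gamma_nat_eq_factorial, abs_of_nonneg (by positivity), ← div_eq_mul_inv,
      div_le_iff₀ (by positivity)]
    norm_cast
    rcases le_or_gt N q with hle | hgt
    · calc N.factorial ≤ q.factorial := Nat.factorial_le hle
        _ ≤ x.natAbs.factorial * 2 ^ N * q.factorial :=
          Nat.le_mul_of_pos_left _ (by positivity)
    · obtain ⟨p, rfl⟩ : ∃ p, N = q + p := ⟨N - q, by lia⟩
      have hx : x.natAbs = p := by lia
      rw [hx, ← Nat.choose_mul_factorial_mul_factorial (Nat.le_add_right q p),
        Nat.add_sub_cancel_left]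
      calc (q + p).choose q * q.factorial * p.factorial
          ≤ 2 ^ (q + p) * q.factorial * p.factorial := by
            gcongr; exact Nat.choose_le_two_pow _ _
        _ = _ := by ring

/-- With `b k = (k + 1)² / 256 + C`, the factors `(k(k + 1) + α) · 2ξ` are at most `b k`; the 2
absorbs `|ξ / (ξ - 1)| ≤ 2ξ`. The constant 256 leaves the ratios `2·2·2·16/256 = 1/2` in `m` and
`2·2/256 = 1/64` in `n`. -/
theorem abs_phiTerm_le {r α ξ R C D : ℝ} {x : ℤ} (hα : 0 < α) (hξ : 0 < ξ) (hξ' : ξ ≤ 1 / 512)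
    (hr : 0 ≤ r) (hC : 2 * (α * ξ) ≤ C) (hR : r * ξ ^ x ≤ R)
    (hD : ∀ N : ℕ, ∏ k ∈ Finset.range N, ((1 / 256 : ℝ) * ((k : ℝ) + 1) ^ 2 + C) ≤
      D * ((1 / 256) ^ N * (N.factorial : ℝ) ^ 2)) (m n : ℕ) :
    |phiTerm r α ξ x m n| ≤
      √R * D * x.natAbs.factorial * (1 / 2) ^ m * (1 / 64) ^ n := by
  have hC0 : 0 ≤ C := by nlinarith [mul_pos hα hξ]
  have hη : |ξ / (ξ - 1)| ≤ 2 * ξ := by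
    rw [abs_div, abs_of_pos hξ, abs_of_neg (by linarith : ξ - 1 < 0),
      div_le_iff₀ (by linarith)]
    nlinarith
  set b : ℕ → ℝ := fun k => (1 / 256 : ℝ) * ((k : ℝ) + 1) ^ 2 + C with hb
  have hb0 : ∀ k, 0 < b k := fun k => by simp only [hb]; positivity
  have hab : ∀ k : ℕ, ((k : ℝ) * (k + 1) + α) * (2 * ξ) ≤ b k := fun k => by
    have h1 : (k : ℝ) * (k + 1) * (2 * ξ) ≤ ((k : ℝ) + 1) ^ 2 * (1 / 256) := by
      have hk : (0 : ℝ) ≤ k := k.cast_nonneg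
      exact mul_le_mul (by nlinarith) (by linarith) (by positivity) (by positivity)
    simp only [hb]
    linarith
  set P : ℕ → ℝ := fun N => ∏ k ∈ Finset.range N, b k with hP
  have hP0 : ∀ N, 0 < P N := fun N => Finset.prod_pos fun k _ => hb0 k
  have h1 : √(r * ξ ^ x * ∏ k ∈ Finset.range m, (((k : ℝ) * (k + 1) + α) * ξ)) ≤
      √R * √(P m) := by
    have hR0 : 0 ≤ R := le_trans (by positivity) hR
    rw [← Real.sqrt_mul hR0]
    refine Real.sqrt_le_sqrt (mul_le_mul hR ?_ (Finset.prod_nonneg fun k _ => by positivity) hR0)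
    refine Finset.prod_le_prod (fun k _ => by positivity) fun k _ => le_trans ?_ (hab k)
    have : 0 ≤ (k : ℝ) * (k + 1) + α := by positivity
    nlinarith
  have h2 : |((1 - ξ)⁻¹) ^ m| ≤ 2 ^ m := by
    rw [abs_of_nonneg (pow_nonneg (inv_nonneg.2 (by linarith)) _)]
    refine pow_le_pow_left₀ (inv_nonneg.2 (by linarith)) ?_ _
    rw [inv_le_comm₀ (by linarith) two_pos]
    linarith
  have h3 : |(∏ j ∈ Finset.range n, (((m + j : ℕ) : ℝ) * ((m + j : ℕ) + 1) + α)) *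
      (ξ / (ξ - 1)) ^ n| ≤ ∏ j ∈ Finset.range n, b (m + j) := by
    rw [abs_mul, abs_pow, abs_of_nonneg (Finset.prod_nonneg fun j _ => by positivity)]
    calc _ ≤ (∏ j ∈ Finset.range n, (((m + j : ℕ) : ℝ) * ((m + j : ℕ) + 1) + α)) *
          (2 * ξ) ^ n := by gcongr
      _ = ∏ j ∈ Finset.range n, ((((m + j : ℕ) : ℝ) * ((m + j : ℕ) + 1) + α) * (2 * ξ)) := by
          rw [Finset.prod_mul_distrib, Finset.prod_const, Finset.card_range]
      _ ≤ _ := Finset.prod_le_prod (fun j _ => by positivity) fun j _ => hab (m + j)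
  have h4 : |(Real.Gamma (((m + n : ℕ) : ℝ) + x + 1))⁻¹| ≤
      x.natAbs.factorial * 2 ^ (m + n) / (m + n).factorial := by
    rw [le_div_iff₀' (by positivity)]
    exact factorial_mul_abs_inv_Gamma_le x (m + n)
  have h5 : (1 / 16 : ℝ) ^ m * m.factorial ≤ √(P m) := by
    refine Real.le_sqrt_of_sq_le ?_
    have : ∏ k ∈ Finset.range m, (1 / 256 : ℝ) * ((k : ℝ) + 1) ^ 2 ≤ P m :=
      Finset.prod_le_prod (fun k _ => by positivity) fun k _ => by simp only [hb]; linarith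
    rw [prod_range_sq_mul] at this
    refine le_trans (le_of_eq ?_) this
    rw [mul_pow, ← pow_mul, mul_comm m 2, pow_mul]
    norm_num
  -- The first `m` factors occur only under a root: the left side is `P (m + n) / √(P m)`, so the
  -- lower bound `h5` is needed too.
  have h6 : √(P m) * ∏ j ∈ Finset.range n, b (m + j) ≤
      D * ((1 / 256) ^ (m + n) * ((m + n).factorial : ℝ) ^ 2) /
        ((1 / 16 : ℝ) ^ m * m.factorial) := by
    rw [le_div_iff₀ (by positivity)]
    have hq : 0 < ∏ j ∈ Finset.range n, b (m + j) := Finset.prod_pos fun j _ => hb0 _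
    calc _ ≤ √(P m) * (∏ j ∈ Finset.range n, b (m + j)) * √(P m) := by gcongr
      _ = P (m + n) := by
        rw [mul_right_comm, Real.mul_self_sqrt (hP0 m).le]
        exact (Finset.prod_range_add b m n).symm
      _ ≤ _ := hD (m + n)
  have h7 : ((m + n).factorial : ℝ) ≤ 2 ^ (m + n) * (m.factorial * n.factorial) := by
    rw [← Nat.choose_mul_factorial_mul_factorial (Nat.le_add_right m n), Nat.add_sub_cancel_left]
    push_cast
    rw [mul_assoc]
    gcongr
    exact_mod_cast Nat.choose_le_two_pow _ _
  have hD0 : 0 ≤ D := by simpa using zero_le_one.trans (hD 0)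
  rw [phiTerm, abs_mul, abs_mul, abs_mul, abs_div, abs_of_nonneg (Real.sqrt_nonneg _),
    Nat.abs_cast]
  calc _ ≤ √R * √(P m) * 2 ^ m * ((∏ j ∈ Finset.range n, b (m + j)) / n.factorial *
        (x.natAbs.factorial * 2 ^ (m + n) / (m + n).factorial)) := by gcongr
    _ = √R * 2 ^ m * (x.natAbs.factorial * 2 ^ (m + n) / (m + n).factorial) / n.factorial *
        (√(P m) * ∏ j ∈ Finset.range n, b (m + j)) := by ring
    _ ≤ √R * 2 ^ m * (x.natAbs.factorial * 2 ^ (m + n) / (m + n).factorial) / n.factorial *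
        (D * ((1 / 256) ^ (m + n) * ((m + n).factorial : ℝ) ^ 2) /
        ((1 / 16 : ℝ) ^ m * m.factorial)) := by gcongr
    _ = √R * D * x.natAbs.factorial * (2 ^ m * 2 ^ (m + n) * (1 / 256) ^ (m + n) * 16 ^ m /
        (m.factorial * n.factorial)) * (m + n).factorial := by
        rw [one_div_pow 16]
        field_simp
    _ ≤ √R * D * x.natAbs.factorial * (2 ^ m * 2 ^ (m + n) * (1 / 256) ^ (m + n) * 16 ^ m /
        (m.factorial * n.factorial)) * (2 ^ (m + n) * (m.factorial * n.factorial)) := by gcongr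
    _ = √R * D * x.natAbs.factorial *
        ((2 ^ m * 2 ^ m * (1 / 256) ^ m * 16 ^ m * 2 ^ m) *
          (2 ^ n * (1 / 256) ^ n * 2 ^ n)) := by
        field_simp
        ring
    _ = _ := by
        simp only [← mul_pow]
        norm_num
        ring

/-! ### Termwise limits and convergence of `φ_m`. -/

theorem tendsto_ratio_mul_zpow {ι : Type*} {l : Filter ι} {α ξ : ι → ℝ} {θ : ℝ} (hθ : 0 < θ)
    (hα : ∀ i, 0 < α i) (hα_lim : Tendsto α l atTop)
    (hαξ_lim : Tendsto (fun i => α i * ξ i) l (𝓝 θ)) {x : ℤ} {r : ℝ → ℝ}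
    (hr : Tendsto (fun α => r α * α ^ (-x)) atTop (𝓝 1)) :
    Tendsto (fun i => r (α i) * ξ i ^ x) l (𝓝 (θ ^ x)) := by
  have h := (hr.comp hα_lim).mul (hαξ_lim.zpow₀ x (Or.inl hθ.ne'))
  rw [one_mul] at h
  refine h.congr fun i => ?_
  have hi : α i ^ x ≠ 0 := zpow_ne_zero _ (hα i).ne'
  simp only [Function.comp]
  rw [mul_zpow, zpow_neg]
  field_simp

theorem tendsto_phiTerm {ι : Type*} {l : Filter ι} {α ξ : ι → ℝ} {θ : ℝ} (hθ : 0 < θ)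
    (hα : ∀ i, 0 < α i) (hα_lim : Tendsto α l atTop) (hξ_lim : Tendsto ξ l (𝓝 0))
    (hαξ_lim : Tendsto (fun i => α i * ξ i) l (𝓝 θ)) {x : ℤ} {r : ℝ → ℝ}
    (hr : Tendsto (fun α => r α * α ^ (-x)) atTop (𝓝 1)) (m n : ℕ) :
    Tendsto (fun i => phiTerm (r (α i)) (α i) (ξ i) x m n) l
      (𝓝 ((-1 : ℝ) ^ n * (2 * √θ / 2) ^ (2 * (n : ℤ) + (m + x : ℤ)) / (n.factorial : ℝ) *
        (Real.Gamma ((n : ℝ) + ((m + x : ℤ) : ℝ) + 1))⁻¹)) := by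
  have hq : ∀ c : ℝ, Tendsto (fun i => (c + α i) * ξ i) l (𝓝 θ) := fun c => by
    simpa [add_mul] using (hξ_lim.const_mul c).add hαξ_lim
  have hsub : Tendsto (fun i => (ξ i - 1)⁻¹) l (𝓝 (-1)) := by
    have := (hξ_lim.sub_const 1).inv₀ (by norm_num)
    norm_num at this
    exact this
  have h1 : Tendsto (fun i => r (α i) * ξ i ^ x *
      ∏ k ∈ Finset.range m, (((k : ℝ) * (k + 1) + α i) * ξ i)) l (𝓝 (θ ^ x * θ ^ m)) := by
    have := tendsto_finsetProd (Finset.range m) fun (k : ℕ) _ => hq ((k : ℝ) * (k + 1))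
    rw [Finset.prod_const, Finset.card_range] at this
    exact (tendsto_ratio_mul_zpow hθ hα hα_lim hαξ_lim hr).mul this
  have h2 : Tendsto (fun i => ((1 - ξ i)⁻¹) ^ m) l (𝓝 1) := by
    simpa using ((hξ_lim.const_sub 1).inv₀ (by norm_num)).pow m
  have h3 : Tendsto (fun i => (∏ j ∈ Finset.range n,
      (((m + j : ℕ) : ℝ) * ((m + j : ℕ) + 1) + α i)) * (ξ i / (ξ i - 1)) ^ n) l
      (𝓝 ((-θ) ^ n)) := by
    have := tendsto_finsetProd (Finset.range n) fun (j : ℕ) _ =>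
      (hq (((m + j : ℕ) : ℝ) * ((m + j : ℕ) + 1))).mul hsub
    rw [Finset.prod_const, Finset.card_range, mul_neg_one] at this
    refine this.congr fun i => ?_
    rw [Finset.prod_mul_distrib, Finset.prod_mul_distrib]
    simp only [Finset.prod_const, Finset.card_range]
    rw [mul_assoc, ← mul_pow, div_eq_mul_inv]
  have h := (h1.sqrt.mul h2).mul ((h3.div_const (n.factorial : ℝ)).mul_const
    (Real.Gamma (((m + n : ℕ) : ℝ) + x + 1))⁻¹)
  refine (h.congr fun i => rfl).trans (le_of_eq ?_)
  congr 1
  have hs : 0 < √θ := Real.sqrt_pos.2 hθ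
  have e1 : √(θ ^ x * θ ^ m) = √θ ^ ((m : ℤ) + x) := by
    rw [Real.sqrt_eq_iff_mul_self_eq (by positivity) (by positivity), ← mul_zpow,
      Real.mul_self_sqrt hθ.le, zpow_add₀ hθ.ne', zpow_natCast, mul_comm]
  have e2 : (2 * √θ / 2) ^ (2 * (n : ℤ) + (m + x : ℤ)) = θ ^ n * √θ ^ ((m : ℤ) + x) := by
    rw [mul_div_cancel_left₀ _ two_ne_zero, zpow_add₀ hs.ne', zpow_mul, zpow_natCast]
    congr 2
    exact_mod_cast Real.sq_sqrt hθ.le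
  rw [e1, e2, neg_pow θ]
  push_cast
  rw [show (n : ℝ) + (m + x) + 1 = m + n + x + 1 by ring]
  ring

theorem exists_bound_and_tendsto_phiFun {ι : Type*} {l : Filter ι} {α ξ : ι → ℝ} {θ : ℝ}
    (hθ : 0 < θ) (hα : ∀ i, 0 < α i) (hξ : ∀ i, ξ i ∈ Set.Ioo (0 : ℝ) 1)
    (hα_lim : Tendsto α l atTop) (hξ_lim : Tendsto ξ l (𝓝 0))
    (hαξ_lim : Tendsto (fun i => α i * ξ i) l (𝓝 θ)) (x : ℤ) :
    ∃ D, 0 ≤ D ∧ (∀ᶠ i in l, ∀ m : ℕ, ‖phiFun m x (α i) (ξ i)‖ ≤ D * (1 / 2) ^ m) ∧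
      ∀ m : ℕ, Tendsto (fun i => phiFun m x (α i) (ξ i)) l
        (𝓝 ((besselJ (m + x) (2 * √θ) : ℝ) : ℂ)) := by
  obtain ⟨r, hr, hr_lim⟩ := exists_gammaPair_ratio x
  obtain ⟨D, hD0, hD⟩ := exists_prod_le_pow_mul_factorial_sq (ε := 1 / 256) (C := 2 * (θ + 1))
    (by norm_num) (by positivity)
  set K : ℝ := √(θ ^ x + 1) * D * x.natAbs.factorial with hK
  have hK0 : 0 ≤ K := by positivity
  have hbound : ∀ᶠ i in l, ∀ m n : ℕ, |phiTerm (r (α i)) (α i) (ξ i) x m n| ≤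
      K * (1 / 2) ^ m * (1 / 64) ^ n := by
    filter_upwards [hξ_lim.eventually_le_const (by norm_num : (0 : ℝ) < 1 / 512),
      hαξ_lim.eventually_le_const (lt_add_one θ),
      (tendsto_ratio_mul_zpow hθ hα hα_lim hαξ_lim hr_lim).eventually_le_const
        (lt_add_one (θ ^ x))] with i h1 h2 h3 m n
    exact abs_phiTerm_le (hα i) (hξ i).1 h1 (hr _ (hα i)).1.le (by linarith) h3 hD m n
  have heq : ∀ᶠ i in l, ∀ m : ℕ, phiFun m x (α i) (ξ i) =
      ((∑' n, phiTerm (r (α i)) (α i) (ξ i) x m n : ℝ) : ℂ) := by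
    filter_upwards [hξ_lim.eventually_lt_const (by norm_num : (0 : ℝ) < 1 / 2)] with i hi m
    exact phiFun_eq_tsum (hα i) (hξ i).1 hi (hr _ (hα i)).1 (hr _ (hα i)).2 m
  have hgeom : HasSum (fun n : ℕ => (1 / 64 : ℝ) ^ n) (1 - 1 / 64)⁻¹ :=
    hasSum_geometric_of_lt_one (by norm_num) (by norm_num)
  refine ⟨K * (1 - 1 / 64)⁻¹, by positivity, ?_, fun m => ?_⟩
  · filter_upwards [hbound, heq] with i h1 h2 m
    rw [h2, Complex.norm_real, mul_right_comm]
    exact tsum_of_norm_bounded (hgeom.mul_left (K * (1 / 2) ^ m)) fun n => h1 m n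
  · have h : Tendsto (fun i => ∑' n, phiTerm (r (α i)) (α i) (ξ i) x m n) l
        (𝓝 (besselJ (m + x) (2 * √θ))) :=
      tendsto_tsum_of_dominated_convergence (hgeom.summable.mul_left (K * (1 / 2) ^ m))
        (fun n => tendsto_phiTerm hθ hα hα_lim hξ_lim hαξ_lim hr_lim m n)
        (hbound.mono fun i hi n => hi m n)
    refine ((Complex.continuous_ofReal.tendsto _).comp h).congr' ?_
    filter_upwards [heq] with i hi
    exact (hi m).symm

/-- The uniform bound on `φ_m` passes to the limit along a concrete sequence with `αξ = θ`. An
arbitrary filter `l` would not do, as it may be trivial. -/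
theorem exists_abs_besselJ_le {θ : ℝ} (hθ : 0 < θ) (x : ℤ) :
    ∃ D, 0 ≤ D ∧ ∀ m : ℕ, |besselJ (m + x) (2 * √θ)| ≤ D * (1 / 2) ^ m := by
  have hα_lim : Tendsto (fun n : ℕ => (n : ℝ) + 1 + θ) atTop atTop :=
    tendsto_atTop_add_const_right _ _ (tendsto_atTop_add_const_right _ _
      tendsto_natCast_atTop_atTop)
  have hpos : ∀ n : ℕ, 0 < (n : ℝ) + 1 + θ := fun n => by positivity
  obtain ⟨D, hD0, hD, hlim⟩ := exists_bound_and_tendsto_phiFun (l := atTop)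
    (α := fun n : ℕ => (n : ℝ) + 1 + θ) (ξ := fun n : ℕ => θ / ((n : ℝ) + 1 + θ)) hθ hpos
    (fun n => ⟨div_pos hθ (hpos n), (div_lt_one (hpos n)).2 (by linarith [n.cast_nonneg (α := ℝ)])⟩)
    hα_lim (tendsto_const_nhds.div_atTop hα_lim)
    (tendsto_const_nhds.congr fun n => (mul_div_cancel₀ θ (hpos n).ne').symm) x
  refine ⟨D, hD0, fun m => ?_⟩
  have := le_of_tendsto (hlim m).norm (hD.mono fun i hi => hi m)
  rwa [Complex.norm_real] at this

/-! ### Convergence of the kernel. -/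

theorem two_zpow_neg_kronZero_le_one (m : ℕ) : (2 : ℝ) ^ (-kronZero m) ≤ 1 :=
  zpow_le_one_of_nonpos₀ one_le_two (by unfold kronZero; split_ifs <;> simp)

theorem exp_neg_mul_sub_le_one {s t : ℝ} (hst : s ≤ t) (m : ℕ) :
    Real.exp (-(m : ℝ) * (t - s)) ≤ 1 :=
  Real.exp_le_one_iff.2 (by nlinarith [m.cast_nonneg (α := ℝ)])

theorem summable_const_mul_half_pow_mul (C D : ℝ) :
    Summable fun m : ℕ => C * (1 / 2) ^ m * (D * (1 / 2) ^ m) := by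
  refine ((summable_geometric_of_lt_one (r := (1 / 4 : ℝ)) (by norm_num)
    (by norm_num)).mul_left (C * D)).congr fun m => ?_
  rw [show (1 / 4 : ℝ) = 1 / 2 * (1 / 2) by norm_num, mul_pow]
  ring

theorem theorem10p2 {ι : Type*} (l : Filter ι) (α ξ : ι → ℝ) (θ : ℝ) (hθ : 0 < θ)
    (hα : ∀ i, 0 < α i) (hξ : ∀ i, ξ i ∈ Set.Ioo (0 : ℝ) 1)
    (hα_lim : Tendsto α l atTop) (hξ_lim : Tendsto ξ l (𝓝 0))
    (hαξ_lim : Tendsto (fun i => α i * ξ i) l (𝓝 θ))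
    (s t : ℝ) (hs : 0 ≤ s) (hst : s ≤ t) (x y : ℤ) :
    (∀ᶠ i in l, Summable (extKernelTerm (α i) (ξ i) s x t y)) ∧
      Summable (besselKernelTerm θ s x t y) ∧
      Tendsto (fun i => extKernel (α i) (ξ i) s x t y) l
        (𝓝 ((besselKernel θ s x t y : ℝ) : ℂ)) := by
  obtain ⟨C, hC0, hC, hC_lim⟩ :=
    exists_bound_and_tendsto_phiFun hθ hα hξ hα_lim hξ_lim hαξ_lim x
  obtain ⟨D, hD0, hD, hD_lim⟩ :=
    exists_bound_and_tendsto_phiFun hθ hα hξ hα_lim hξ_lim hαξ_lim (-y)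
  have hbound : ∀ᶠ i in l, ∀ m : ℕ, ‖extKernelTerm (α i) (ξ i) s x t y m‖ ≤
      C * (1 / 2) ^ m * (D * (1 / 2) ^ m) := by
    filter_upwards [hC, hD] with i h1 h2 m
    rw [extKernelTerm, norm_mul, norm_mul, norm_mul, norm_zpow, Complex.norm_real,
      Complex.norm_ofNat, Real.norm_of_nonneg (Real.exp_pos _).le]
    -- The weights are only bounded by 1; all decay comes from the two `φ` factors, so `s = t` is
    -- covered.
    refine mul_le_mul (le_trans ?_ (h1 m)) (h2 m) (norm_nonneg _) (by positivity)
    refine mul_le_of_le_one_left (norm_nonneg _) (mul_le_one₀ (two_zpow_neg_kronZero_le_one m)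
      (Real.exp_pos _).le (exp_neg_mul_sub_le_one hst m))
  have hsum := summable_const_mul_half_pow_mul C D
  refine ⟨hbound.mono fun i hi => Summable.of_norm_bounded hsum hi, ?_, ?_⟩
  · obtain ⟨C', hC0', hC'⟩ := exists_abs_besselJ_le hθ x
    obtain ⟨D', hD0', hD'⟩ := exists_abs_besselJ_le hθ (-y)
    refine Summable.of_norm_bounded (summable_const_mul_half_pow_mul C' D') fun m => ?_
    rw [besselKernelTerm, norm_mul, norm_mul, norm_mul, norm_zpow,
      Real.norm_ofNat, Real.norm_of_nonneg (Real.exp_pos _).le, sub_eq_add_neg (m : ℤ) y]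
    refine mul_le_mul (le_trans ?_ (hC' m)) (hD' m) (norm_nonneg _) (by positivity)
    refine mul_le_of_le_one_left (norm_nonneg _) (mul_le_one₀ (two_zpow_neg_kronZero_le_one m)
      (Real.exp_pos _).le (exp_neg_mul_sub_le_one hst m))
  · rw [besselKernel]
    push_cast
    refine Tendsto.const_mul _ (tendsto_tsum_of_dominated_convergence hsum (fun m => ?_) hbound)
    rw [besselKernelTerm, sub_eq_add_neg (m : ℤ) y]
    push_cast
    have := ((hC_lim m).const_mul ((2 : ℂ) ^ (-kronZero m) *
      (Real.exp (-(m : ℝ) * (t - s)) : ℂ))).mul (hD_lim m)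
    push_cast at this
    simpa only [extKernelTerm, Complex.ofReal_exp, Complex.ofReal_mul, Complex.ofReal_neg,
      Complex.ofReal_sub, Complex.ofReal_natCast] using this
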